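/- Notation: for complex $a,q$ let $(a;q)_n=\prod_{k=0}^{n-1}(1-aq^k)$ for $n\ge 0$ and, for $|q|<1$, $(a;q)_\infty=\prod_{k=0}^{\infty}(1-aq^k)$; moreover $(a_1,\dots,a_j;q)_n=(a_1;q)_n\cdots(a_j;q)_n$, also for $n=\infty$. Theorem. Let $m$ be a positive integer and let $z,q\in\mathbb{C}$ with $z\neq 0$, $q\neq 0$ and $|q|<1$. Then $$\sum_{r=0}^{m-1}q^{2r^2-2r}z^r\left(1+z^mq^{2m^2+(4r-2)m}\right)\sum_{n=0}^{\infty}\frac{q^{m^2(n^2+2n)}\left(-q^{m^2};q^{2m^2}\right)_{n+1}\left(-q^{3m^2+m(4r-2)}z^m,\ \dfrac{-1}{q^{m^2+m(4r-2)}z^m};\,q^{2m^2}\right)_n}{(q^{2m^2};q^{2m^2})_{2n+1}}$$ $$=\left(-z,\,-q^4/z,\,q^4;\,q^4\right)_\infty\,\frac{(-q^{m^2};q^{2m^2})_\infty}{(q^{2m^2};q^{2m^2})_\infty},$$ where each of the inner series (for $0\le r\le m-1$) converges absolutely. -/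

import Mathlib

open scoped BigOperators

noncomputable section

/-- The finite `q`-shifted factorial `(a; q)_n = ∏_{k=0}^{n-1} (1 - a q^k)`. -/
def qPoch (a q : ℂ) (n : ℕ) : ℂ := ∏ k ∈ Finset.range n, (1 - a * q ^ k)

/-- The infinite `q`-shifted factorial `(a; q)_∞ = ∏_{k=0}^∞ (1 - a q^k)`, used for `|q| < 1`. -/
def qPochInf (a q : ℂ) : ℂ := ∏' k : ℕ, (1 - a * q ^ k)

/-- For `|q| < 1` the product defining `(a; q)_∞` converges unconditionally. -/
theorem multipliable_qPochInf (a q : ℂ) (hq : ‖q‖ < 1) :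
    Multipliable (fun k : ℕ => 1 - a * q ^ k) := by
  have h : Summable (fun k : ℕ => ‖-(a * q ^ k)‖) := by
    simp only [norm_neg, norm_mul, norm_pow]
    exact (summable_geometric_of_lt_one (norm_nonneg q) hq).mul_left _
  simpa [sub_eq_add_neg] using multipliable_one_add_of_summable h

/-- For `|q| < 1`, `(a; q)_∞` is the limit of `(a; q)_n` as `n → ∞`. -/
theorem tendsto_qPoch (a q : ℂ) (hq : ‖q‖ < 1) :
    Filter.Tendsto (qPoch a q) Filter.atTop (nhds (qPochInf a q)) :=
  (multipliable_qPochInf a q hq).hasProd.tendsto_prod_nat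

/-- The `n`-th term of the inner series belonging to the residue `r`:
`q^{m²(n²+2n)} (-q^{m²}; q^{2m²})_{n+1} (-q^{3m²+m(4r-2)} z^m, -1/(q^{m²+m(4r-2)} z^m); q^{2m²})_n
  / (q^{2m²}; q^{2m²})_{2n+1}`.
Exponents that may be negative are integer exponents. -/
def dissectionTerm (m : ℕ) (z q : ℂ) (r n : ℕ) : ℂ :=
  q ^ (m ^ 2 * (n ^ 2 + 2 * n)) *
      qPoch (-q ^ (m ^ 2)) (q ^ (2 * m ^ 2)) (n + 1) *
      (qPoch (-q ^ (3 * (m : ℤ) ^ 2 + m * (4 * r - 2)) * z ^ m) (q ^ (2 * m ^ 2)) n *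
        qPoch (-1 / (q ^ ((m : ℤ) ^ 2 + m * (4 * r - 2)) * z ^ m)) (q ^ (2 * m ^ 2)) n) /
    qPoch (q ^ (2 * m ^ 2)) (q ^ (2 * m ^ 2)) (2 * n + 1)

end

open Filter Topology

/-! The right side is a theta series split by residues mod `m`. By Jacobi's triple product, its
theta factor is the sum of `q^(2j²-2j) z^j` over `j : ℤ` (`hasSum_theta`). Replacing `j` by `jm + r`
and fixing `r` leaves, up to a prefactor, the sum of `t^(2j²-2j) y^j` with `t = q^(m²)` and `y = z^m
q^(2m²+(4r-2)m)`.

It remains to identify this, times `(-t;t²)_∞/(t²;t²)_∞`, with `1 + y` times the inner series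
(`exists_hasSum_series`). The finite Jacobi identity `hasSum_finite_jacobi` expands each inner term
in powers of `y`. After multiplication by `1 + y`, two neighbouring coefficients merge into one
product (`seriesCoeff_add`), whose sum over `n` is a limiting `q`-Gauss sum (`hasSum_qGauss_int`).
Absolute convergence of the double series permits the interchange. -/

/-! ### Finite and infinite `q`-shifted factorials: recursions, bounds, nonvanishing. -/

theorem qPoch_zero (a q : ℂ) : qPoch a q 0 = 1 := by simp [qPoch]

theorem qPoch_succ (a q : ℂ) (n : ℕ) : qPoch a q (n + 1) = qPoch a q n * (1 - a * q ^ n) := by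
  simp [qPoch, Finset.prod_range_succ]

theorem qPoch_succ' (a q : ℂ) (n : ℕ) :
    qPoch a q (n + 1) = (1 - a) * qPoch (a * q) q n := by
  rw [qPoch, Finset.prod_range_succ', mul_comm]
  simp [qPoch, pow_succ', mul_assoc]

theorem qPoch_add (a q : ℂ) (m n : ℕ) :
    qPoch a q (m + n) = qPoch a q m * qPoch (a * q ^ m) q n := by
  simp [qPoch, Finset.prod_range_add, pow_add, mul_assoc]

theorem one_sub_mul_pow_ne_zero {a q : ℂ} (ha : ‖a‖ < 1) (hq : ‖q‖ ≤ 1) (k : ℕ) :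
    1 - a * q ^ k ≠ 0 := by
  intro h
  have h1 : ‖a * q ^ k‖ = 1 := by rw [← sub_eq_zero.mp h, norm_one]
  have h2 : ‖a * q ^ k‖ ≤ ‖a‖ := by
    rw [norm_mul, norm_pow]
    exact mul_le_of_le_one_right (norm_nonneg _) (pow_le_one₀ (norm_nonneg _) hq)
  linarith

theorem qPoch_ne_zero {a q : ℂ} (ha : ‖a‖ < 1) (hq : ‖q‖ ≤ 1) (n : ℕ) : qPoch a q n ≠ 0 :=
  Finset.prod_ne_zero_iff.mpr fun k _ => one_sub_mul_pow_ne_zero ha hq k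

theorem norm_qPoch_le (a : ℂ) {q : ℂ} (hq : ‖q‖ ≤ 1) (n : ℕ) :
    ‖qPoch a q n‖ ≤ (1 + ‖a‖) ^ n := by
  induction n with
  | zero => simp [qPoch_zero]
  | succ n ih =>
    rw [qPoch_succ, norm_mul, pow_succ]
    have h2 : ‖a * q ^ n‖ ≤ ‖a‖ := by
      rw [norm_mul, norm_pow]
      exact mul_le_of_le_one_right (norm_nonneg _) (pow_le_one₀ (norm_nonneg _) hq)
    have h3 := norm_sub_le 1 (a * q ^ n)
    rw [norm_one] at h3
    exact mul_le_mul ih (by linarith) (norm_nonneg _) (by positivity)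

theorem le_norm_qPoch {a q : ℂ} (ha : ‖a‖ ≤ 1) (hq : ‖q‖ ≤ 1) (n : ℕ) :
    (1 - ‖a‖) ^ n ≤ ‖qPoch a q n‖ := by
  induction n with
  | zero => simp [qPoch_zero]
  | succ n ih =>
    rw [qPoch_succ, norm_mul, pow_succ]
    have h2 : ‖a * q ^ n‖ ≤ ‖a‖ := by
      rw [norm_mul, norm_pow]
      exact mul_le_of_le_one_right (norm_nonneg _) (pow_le_one₀ (norm_nonneg _) hq)
    have h3 := norm_sub_norm_le 1 (a * q ^ n)
    rw [norm_one] at h3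
    exact mul_le_mul ih (by linarith) (by linarith) (norm_nonneg _)

theorem qPochInf_ne_zero {a q : ℂ} (ha : ‖a‖ < 1) (hq : ‖q‖ < 1) : qPochInf a q ≠ 0 := by
  have h := tprod_one_add_ne_zero_of_summable (f := fun k : ℕ => -(a * q ^ k))
    (fun k => by simpa [sub_eq_add_neg] using one_sub_mul_pow_ne_zero ha hq.le k)
    (by
      simp only [norm_neg, norm_mul, norm_pow]
      exact (summable_geometric_of_lt_one (norm_nonneg q) hq).mul_left _)
  simpa [qPochInf, sub_eq_add_neg] using h

theorem qPochInf_eq_qPoch_mul (a : ℂ) {q : ℂ} (hq : ‖q‖ < 1) (m : ℕ) :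
    qPochInf a q = qPoch a q m * qPochInf (a * q ^ m) q := by
  refine tendsto_nhds_unique ((tendsto_qPoch a q hq).comp (tendsto_add_atTop_nat m)) ?_
  refine ((tendsto_qPoch (a * q ^ m) q hq).const_mul (qPoch a q m)).congr fun n => ?_
  simp [add_comm n m, qPoch_add]

theorem exists_norm_qPoch_le (a : ℂ) {q : ℂ} (hq : ‖q‖ < 1) : ∃ C, ∀ n, ‖qPoch a q n‖ ≤ C := by
  obtain ⟨C, hC⟩ := (Metric.isBounded_range_of_tendsto _ (tendsto_qPoch a q hq)).exists_norm_le
  exact ⟨C, fun n => hC _ ⟨n, rfl⟩⟩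

theorem exists_norm_inv_qPoch_le {a q : ℂ} (ha : ‖a‖ < 1) (hq : ‖q‖ < 1) :
    ∃ C, ∀ n, ‖(qPoch a q n)⁻¹‖ ≤ C := by
  obtain ⟨C, hC⟩ := (Metric.isBounded_range_of_tendsto _
    ((tendsto_qPoch a q hq).inv₀ (qPochInf_ne_zero ha hq))).exists_norm_le
  exact ⟨C, fun n => hC _ ⟨n, rfl⟩⟩

/-! ### Convergence of series with quadratic exponents. -/

theorem summable_pow_mul_pow_choose_two (K : ℝ) {ρ : ℝ} (h0 : 0 ≤ ρ) (h1 : ρ < 1) :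
    Summable fun n : ℕ => K ^ n * ρ ^ n.choose 2 := by
  have ht : Tendsto (fun n : ℕ => |K| * ρ ^ n) atTop (𝓝 0) := by
    simpa using (tendsto_pow_atTop_nhds_zero_of_lt_one h0 h1).const_mul |K|
  refine summable_of_ratio_norm_eventually_le (r := 1 / 2) (by norm_num) ?_
  filter_upwards [ht.eventually_le_const (show (0 : ℝ) < 1 / 2 by norm_num)] with n hn
  have : K ^ (n + 1) * ρ ^ (n + 1).choose 2 = K * ρ ^ n * (K ^ n * ρ ^ n.choose 2) := by
    rw [Nat.choose_succ_succ' n 1, Nat.choose_one_right, pow_add, pow_succ]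
    ring
  rw [this, norm_mul]
  gcongr
  simpa [abs_of_nonneg h0] using hn

theorem sq_eq_add_two_mul_choose_two (n : ℕ) : n ^ 2 = n + 2 * n.choose 2 := by
  induction n with
  | zero => simp
  | succ n ih =>
    rw [Nat.choose_succ_succ' n 1, Nat.choose_one_right]
    linarith

theorem summable_pow_mul_pow_sq (K : ℝ) {ρ : ℝ} (h0 : 0 ≤ ρ) (h1 : ρ < 1) :
    Summable fun n : ℕ => K ^ n * ρ ^ n ^ 2 := by
  refine (summable_pow_mul_pow_choose_two (K * ρ) (ρ := ρ ^ 2) (by positivity)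
    (pow_lt_one₀ h0 h1 two_ne_zero)).congr fun n => ?_
  rw [sq_eq_add_two_mul_choose_two n, pow_add, pow_mul, mul_pow, mul_assoc]

theorem summable_zpow_sq_mul_zpow {t : ℂ} (ht : ‖t‖ < 1) (y : ℂ) :
    Summable fun j : ℤ => ‖t ^ j ^ 2 * y ^ j‖ := by
  refine Summable.of_nat_of_neg ?_ ?_
  · refine (summable_pow_mul_pow_sq ‖y‖ (norm_nonneg t) ht).congr fun n => ?_
    rw [norm_mul, zpow_natCast, norm_pow, mul_comm, ← Nat.cast_pow, zpow_natCast, norm_pow]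
  · refine (summable_pow_mul_pow_sq ‖y‖⁻¹ (norm_nonneg t) ht).congr fun n => ?_
    rw [norm_mul, neg_sq, zpow_neg, zpow_natCast, norm_inv, norm_pow, mul_comm, ← Nat.cast_pow,
      zpow_natCast, norm_pow, inv_pow]

/-! ### The limiting `q`-Gauss sum. -/

/-- The terms of the limiting case of the `q`-Gauss series. -/
noncomputable def qGaussTerm (a b q : ℂ) (k : ℕ) : ℂ :=
  qPoch a q k * (-b) ^ k * q ^ k.choose 2 / (qPoch q q k * qPoch (a * b) q k)

/-- The bound sees `b` only through `s` and `r`, so it is uniform along `b * q ^ n`, as dominated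
convergence needs. -/
theorem norm_qGaussTerm_le {a b q : ℂ} {r s : ℝ} (hq : ‖q‖ < 1) (hb : ‖b‖ ≤ s)
    (hab : ‖a * b‖ ≤ r) (hr : r < 1) (k : ℕ) :
    ‖qGaussTerm a b q k‖ ≤
      ((1 + ‖a‖) * s / ((1 - ‖q‖) * (1 - r))) ^ k * ‖q‖ ^ k.choose 2 := by
  have hq' : 0 < 1 - ‖q‖ := by linarith
  have hr' : 0 < 1 - r := by linarith
  rw [qGaussTerm, norm_div, norm_mul, norm_mul, norm_mul, norm_pow, norm_pow, norm_neg,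
    div_pow, mul_pow, mul_pow, div_mul_eq_mul_div]
  have h1 := norm_qPoch_le a hq.le k
  have h2 := le_norm_qPoch hq.le hq.le k
  have h3 := (pow_le_pow_left₀ hr'.le (by linarith) k).trans
    (le_norm_qPoch (hab.trans hr.le) hq.le k)
  have hs : 0 ≤ s := (norm_nonneg b).trans hb
  gcongr

theorem summable_qGaussTerm {a b q : ℂ} (hq : ‖q‖ < 1) (hab : ‖a * b‖ < 1) :
    Summable (qGaussTerm a b q) :=
  (summable_pow_mul_pow_choose_two _ (norm_nonneg q) hq).of_norm_bounded
    (norm_qGaussTerm_le hq le_rfl le_rfl hab)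

theorem tsum_qGaussTerm_step {a b q : ℂ} (hq : ‖q‖ < 1) (hab : ‖a * b‖ < 1) :
    (1 - a * b) * ∑' k, qGaussTerm a b q k = (1 - b) * ∑' k, qGaussTerm a (b * q) q k := by
  have hab' : ‖a * (b * q)‖ < 1 := by
    rw [← mul_assoc, norm_mul]
    exact mul_lt_one_of_nonneg_of_lt_one_left (norm_nonneg _) hab hq.le
  have hs := summable_qGaussTerm hq hab
  have hs' := summable_qGaussTerm hq hab'
  -- The contiguous relation `b ↦ bq` telescopes, with certificate `(1 - q^k)(1 - ab)` times the
  -- `k`-th term.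
  have key : ∀ k, (1 - a * b) * qGaussTerm a b q k - (1 - b) * qGaussTerm a (b * q) q k =
      (1 - q ^ k) * ((1 - a * b) * qGaussTerm a b q k) -
        (1 - q ^ (k + 1)) * ((1 - a * b) * qGaussTerm a b q (k + 1)) := by
    intro k
    have h1 := one_sub_mul_pow_ne_zero hq hq.le k
    have h2 := one_sub_mul_pow_ne_zero hab hq.le k
    have h3 := qPoch_ne_zero hq hq.le k
    have h4 := qPoch_ne_zero hab hq.le k
    have h5 : 1 - a * b ≠ 0 := by simpa using one_sub_mul_pow_ne_zero hab hq.le 0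
    have h6 : qPoch (a * (b * q)) q k = qPoch (a * b) q k * (1 - a * b * q ^ k) / (1 - a * b) := by
      rw [eq_div_iff h5, ← qPoch_succ, qPoch_succ', ← mul_assoc a b q, mul_comm]
    simp only [qGaussTerm]
    rw [h6, qPoch_succ q, qPoch_succ a, qPoch_succ (a * b), pow_succ' q k, Nat.choose_succ_succ' k 1, Nat.choose_one_right,
      pow_add q k, pow_succ (-b), ← neg_mul, mul_pow]
    generalize q ^ k = x at *
    generalize 1 - q * x = d at *
    field_simp
    ring
  have hd := (hs.mul_left (1 - a * b)).sub (hs'.mul_left (1 - b))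
  have hl : Tendsto (fun n => (1 - q ^ n) * ((1 - a * b) * qGaussTerm a b q n)) atTop (𝓝 0) := by
    simpa using ((tendsto_pow_atTop_nhds_zero_of_norm_lt_one hq).const_sub 1).mul
      (hs.tendsto_atTop_zero.const_mul (1 - a * b))
  -- The boundary term at `0` vanishes because `1 - q^0 = 0`, the one at infinity by summability.
  have hz : ∑' k, ((1 - a * b) * qGaussTerm a b q k - (1 - b) * qGaussTerm a (b * q) q k) = 0 := by
    refine tendsto_nhds_unique hd.hasSum.tendsto_sum_nat ?_
    simp_rw [key, Finset.sum_range_sub']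
    simpa using hl.const_sub 0
  rw [(hs.mul_left _).tsum_sub (hs'.mul_left _), tsum_mul_left, tsum_mul_left] at hz
  exact sub_eq_zero.mp hz

/-- The limiting case `₁φ₁(a; ab; q, b) = (b; q)_∞ / (ab; q)_∞` of the `q`-Gauss sum. -/
theorem tsum_qGaussTerm {a b q : ℂ} (hq : ‖q‖ < 1) (hab : ‖a * b‖ < 1) :
    ∑' k, qGaussTerm a b q k = qPochInf b q / qPochInf (a * b) q := by
  have hn : ∀ n : ℕ, ‖b * q ^ n‖ ≤ ‖b‖ ∧ ‖a * (b * q ^ n)‖ ≤ ‖a * b‖ := by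
    intro n
    have h := pow_le_one₀ (norm_nonneg q) hq.le (n := n)
    constructor
    · rw [norm_mul, norm_pow]
      exact mul_le_of_le_one_right (norm_nonneg _) h
    · rw [← mul_assoc, norm_mul _ (q ^ n), norm_pow]
      exact mul_le_of_le_one_right (norm_nonneg _) h
  have hiter : ∀ n : ℕ, qPoch (a * b) q n * ∑' k, qGaussTerm a b q k =
      qPoch b q n * ∑' k, qGaussTerm a (b * q ^ n) q k := by
    intro n
    induction n with
    | zero => simp [qPoch_zero]
    | succ n ih =>
      have h := tsum_qGaussTerm_step hq ((hn n).2.trans_lt hab)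
      rw [qPoch_succ, qPoch_succ, mul_right_comm, ih, pow_succ, ← mul_assoc b, mul_assoc a b]
      linear_combination qPoch b q n * h
  -- As `b q^n → 0`, only the `k = 0` term survives.
  have hterm : ∀ k, Tendsto (fun n : ℕ => qGaussTerm a (b * q ^ n) q k) atTop
      (𝓝 (if k = 0 then 1 else 0)) := by
    intro k
    rcases eq_or_ne k 0 with rfl | hk
    · simp [qGaussTerm, qPoch_zero]
    · have hb : Tendsto (fun n : ℕ => b * q ^ n) atTop (𝓝 0) := by
        simpa using (tendsto_pow_atTop_nhds_zero_of_norm_lt_one hq).const_mul b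
      have hc : ContinuousAt (fun x => qGaussTerm a x q k) 0 := by
        unfold qGaussTerm
        refine ContinuousAt.div (by fun_prop) ?_ ?_
        · unfold qPoch
          fun_prop
        · exact mul_ne_zero (qPoch_ne_zero hq hq.le k) (by simp [qPoch])
      have h := hc.tendsto.comp hb
      simpa [qGaussTerm, hk, Function.comp_def] using h
  have hlim : Tendsto (fun n : ℕ => ∑' k, qGaussTerm a (b * q ^ n) q k) atTop (𝓝 1) := by
    have h := tendsto_tsum_of_dominated_convergence
      (summable_pow_mul_pow_choose_two ((1 + ‖a‖) * ‖b‖ / ((1 - ‖q‖) * (1 - ‖a * b‖)))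
        (norm_nonneg q) hq) hterm
      (Eventually.of_forall fun n k => norm_qGaussTerm_le hq (hn n).1 (hn n).2 hab k)
    simpa using h
  rw [eq_div_iff (qPochInf_ne_zero hab hq), mul_comm]
  refine tendsto_nhds_unique ((tendsto_qPoch (a * b) q hq).mul_const _) ?_
  simp_rw [hiter]
  simpa using (tendsto_qPoch b q hq).mul hlim

/-! ### Reciprocal `q`-factorials on `ℤ` and the Jacobi triple product. -/

/-- The reciprocal `1 / (q; q)_k`, extended by zero to negative integers `k`. -/
noncomputable def invQFactorial (q : ℂ) (k : ℤ) : ℂ :=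
  if 0 ≤ k then (qPoch q q k.toNat)⁻¹ else 0

theorem invQFactorial_natCast (q : ℂ) (n : ℕ) : invQFactorial q n = (qPoch q q n)⁻¹ := by
  simp [invQFactorial]

theorem invQFactorial_of_neg (q : ℂ) {k : ℤ} (hk : k < 0) : invQFactorial q k = 0 :=
  if_neg hk.not_ge

/-- The extension by zero makes the recursion hold for every integer: at `k = 0` the factor `1 -
q^0` vanishes. -/
theorem invQFactorial_sub_one {q : ℂ} (hq : ‖q‖ < 1) (k : ℤ) :
    invQFactorial q (k - 1) = (1 - q ^ k) * invQFactorial q k := by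
  rcases lt_trichotomy k 0 with hk | rfl | hk
  · rw [invQFactorial_of_neg q hk, invQFactorial_of_neg q (by lia), mul_zero]
  · rw [invQFactorial_of_neg q (by lia), zpow_zero, sub_self, zero_mul]
  · obtain ⟨n, rfl⟩ : ∃ n : ℕ, k = (n + 1 : ℕ) := ⟨k.toNat - 1, by lia⟩
    have h := one_sub_mul_pow_ne_zero hq hq.le n
    have h' := qPoch_ne_zero hq hq.le n
    rw [invQFactorial_natCast, zpow_natCast, Nat.cast_succ, add_sub_cancel_right,
      invQFactorial_natCast, qPoch_succ, pow_succ' q n]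
    generalize q ^ n = x at *
    field_simp

theorem exists_norm_invQFactorial_le {q : ℂ} (hq : ‖q‖ < 1) :
    ∃ C, 0 ≤ C ∧ ∀ k, ‖invQFactorial q k‖ ≤ C := by
  obtain ⟨C, hC⟩ := exists_norm_inv_qPoch_le hq hq
  have h0 : 0 ≤ C := (norm_nonneg _).trans (hC 0)
  refine ⟨C, h0, fun k => ?_⟩
  unfold invQFactorial
  split_ifs
  · exact hC _
  · simpa using h0

theorem tendsto_invQFactorial {q : ℂ} (hq : ‖q‖ < 1) :
    Tendsto (invQFactorial q) atTop (𝓝 (qPochInf q q)⁻¹) := by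
  have h : Tendsto Int.toNat atTop atTop :=
    tendsto_atTop.mpr fun b => by
      filter_upwards [eventually_ge_atTop (b : ℤ)] with k hk
      lia
  refine (((tendsto_qPoch q q hq).inv₀ (qPochInf_ne_zero hq hq)).comp h).congr' ?_
  filter_upwards [eventually_ge_atTop 0] with k hk
  simp [invQFactorial, hk]

theorem norm_sq_lt_one {t : ℂ} (ht : ‖t‖ < 1) : ‖t ^ 2‖ < 1 := by
  rw [norm_pow]
  exact pow_lt_one₀ (norm_nonneg t) ht two_ne_zero

/-- The finite form of the Jacobi triple product identity. -/
theorem hasSum_finite_jacobi {t y : ℂ} (ht0 : t ≠ 0) (ht : ‖t‖ < 1) (hy : y ≠ 0) (n : ℕ) :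
    HasSum (fun j : ℤ => qPoch (t ^ 2) (t ^ 2) (2 * n) * invQFactorial (t ^ 2) (n + j) *
        invQFactorial (t ^ 2) (n - j) * (t ^ j ^ 2 * y ^ j))
      (qPoch (-(t * y)) (t ^ 2) n * qPoch (-(t / y)) (t ^ 2) n) := by
  have ht2 := norm_sq_lt_one ht
  induction n with
  | zero =>
    have h := invQFactorial_natCast (t ^ 2) 0
    rw [qPoch_zero, inv_one, Nat.cast_zero] at h
    have hz : ∀ j : ℤ, j ≠ 0 → qPoch (t ^ 2) (t ^ 2) (2 * 0) *
        invQFactorial (t ^ 2) ((0 : ℕ) + j) * invQFactorial (t ^ 2) ((0 : ℕ) - j) *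
          (t ^ j ^ 2 * y ^ j) = 0 := by
      intro j hj
      rcases lt_or_gt_of_ne hj with h | h
      · rw [invQFactorial_of_neg (k := (0 : ℕ) + j) _ (by simpa using h)]
        simp
      · rw [invQFactorial_of_neg (k := (0 : ℕ) - j) _ (by simpa using h)]
        simp
    simpa [qPoch_zero, h] using hasSum_single (0 : ℤ) hz
  | succ n ih =>
    -- The new factor is `(1 + t^(2n+1) y)(1 + t^(2n+1)/y)`; its terms in `y` and `1/y` shift the
    -- summation index by one.
    have h1 := (Equiv.subRight (1 : ℤ)).hasSum_iff.mpr ih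
    have h2 := (Equiv.addRight (1 : ℤ)).hasSum_iff.mpr ih
    convert! ((ih.mul_left (1 + t ^ (4 * n + 2))).add (h1.mul_left (t ^ (2 * n + 1) * y))).add
      (h2.mul_left (t ^ (2 * n + 1) / y)) using 1
    · funext j
      simp only [Function.comp_apply, Equiv.subRight_apply, Equiv.coe_addRight]
      have e1 := invQFactorial_sub_one ht2 (n + 1 + j)
      have e2 := invQFactorial_sub_one ht2 (n + 1 - j)
      have e3 := invQFactorial_sub_one ht2 (n + j)
      have e4 := invQFactorial_sub_one ht2 (n - j)
      rw [show (n + 1 + j - 1 : ℤ) = n + j by ring] at e1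
      rw [show (n + 1 - j - 1 : ℤ) = n - j by ring] at e2
      rw [show ((n + 1 : ℕ) + j : ℤ) = n + 1 + j by push_cast; ring,
        show ((n + 1 : ℕ) - j : ℤ) = n + 1 - j by push_cast; ring,
        show (n + (j - 1) : ℤ) = n + j - 1 by ring, show (n - (j - 1) : ℤ) = n + 1 - j by ring,
        show (n - (j + 1) : ℤ) = n - j - 1 by ring, show (n + (j + 1) : ℤ) = n + 1 + j by ring,
        e3, e4, e1, e2, show 2 * (n + 1) = 2 * n + 1 + 1 by ring, qPoch_succ, qPoch_succ,
        show (j - 1) ^ 2 = j ^ 2 + 1 - j - j by ring, show (j + 1) ^ 2 = j ^ 2 + 1 + j + j by ring]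
      have ht2' : t ^ 2 ≠ 0 := pow_ne_zero 2 ht0
      have hw : t ^ j ≠ 0 := zpow_ne_zero _ ht0
      have hp : (t ^ 2) ^ j = (t ^ j) ^ 2 := by
        rw [← zpow_natCast, ← zpow_natCast, zpow_comm]
      simp only [zpow_add₀ ht2', zpow_sub₀ ht2', zpow_add₀ ht0, zpow_sub₀ ht0, zpow_add₀ hy,
        zpow_sub₀ hy, zpow_one, zpow_natCast, hp, ← pow_mul]
      rw [show t ^ (4 * n + 2) = (t ^ n) ^ 4 * t ^ 2 by ring,
        show t ^ (2 * n + 1) = (t ^ n) ^ 2 * t by ring,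
        show t ^ (2 * n) = (t ^ n) ^ 2 by ring,
        show t ^ (2 * (2 * n)) = (t ^ n) ^ 4 by ring,
        show t ^ (2 * (2 * n + 1)) = (t ^ n) ^ 4 * t ^ 2 by ring]
      generalize invQFactorial (t ^ 2) (n + 1 + j) = g
      generalize invQFactorial (t ^ 2) (n + 1 - j) = h
      generalize t ^ j = w at *
      generalize t ^ n = x at *
      field_simp
      ring
    · rw [qPoch_succ, qPoch_succ, ← pow_mul]
      field_simp
      ring

/-- This is the limit `n → ∞` of the finite form, by dominated convergence. -/
theorem hasSum_jacobi {t y : ℂ} (ht0 : t ≠ 0) (ht : ‖t‖ < 1) (hy : y ≠ 0) :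
    HasSum (fun j : ℤ => t ^ j ^ 2 * y ^ j)
      (qPochInf (-(t * y)) (t ^ 2) * qPochInf (-(t / y)) (t ^ 2) *
        qPochInf (t ^ 2) (t ^ 2)) := by
  have ht2 := norm_sq_lt_one ht
  have hs := summable_zpow_sq_mul_zpow ht y
  obtain ⟨C, hC⟩ := exists_norm_qPoch_le (t ^ 2) ht2
  obtain ⟨D, hD0, hD⟩ := exists_norm_invQFactorial_le ht2
  have hP := qPochInf_ne_zero ht2 ht2
  have hlim := tendsto_tsum_of_dominated_convergence (𝓕 := atTop)
    (f := fun (n : ℕ) (j : ℤ) => qPoch (t ^ 2) (t ^ 2) (2 * n) * invQFactorial (t ^ 2) (n + j) *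
        invQFactorial (t ^ 2) (n - j) * (t ^ j ^ 2 * y ^ j))
    (g := fun j => (qPochInf (t ^ 2) (t ^ 2))⁻¹ * (t ^ j ^ 2 * y ^ j))
    (hs.mul_left (C * D * D)) ?_ ?_
  · simp_rw [(hasSum_finite_jacobi ht0 ht hy _).tsum_eq] at hlim
    have h := tendsto_nhds_unique hlim
      ((tendsto_qPoch (-(t * y)) (t ^ 2) ht2).mul (tendsto_qPoch (-(t / y)) (t ^ 2) ht2))
    rw [tsum_mul_left, inv_mul_eq_iff_eq_mul₀ hP, mul_comm] at h
    rw [← h]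
    exact hs.of_norm.hasSum
  · intro j
    have h1 := (tendsto_qPoch (t ^ 2) (t ^ 2) ht2).comp
      (tendsto_id.const_mul_atTop' (show 0 < 2 by norm_num))
    have h2 := (tendsto_invQFactorial ht2).comp
      (tendsto_atTop_add_const_right _ j tendsto_natCast_atTop_atTop)
    have h3 := (tendsto_invQFactorial ht2).comp
      (tendsto_atTop_add_const_right _ (-j) tendsto_natCast_atTop_atTop)
    have h := ((h1.mul h2).mul h3).mul_const (t ^ j ^ 2 * y ^ j)
    rw [mul_inv_cancel₀ hP, one_mul] at h
    exact h
  · refine Eventually.of_forall fun n j => ?_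
    rw [norm_mul, norm_mul, norm_mul]
    have := hC (2 * n)
    have h0 : 0 ≤ C := (norm_nonneg _).trans this
    gcongr
    · exact hD _
    · exact hD _

/-! ### Summing the coefficients over `n` by `q`-Gauss. -/

theorem one_add_mul_pow_ne_zero {t : ℂ} (ht : ‖t‖ < 1) (n : ℕ) : 1 + t * (t ^ 2) ^ n ≠ 0 := by
  have h := one_sub_mul_pow_ne_zero (a := -t) (by simpa using ht) (norm_sq_lt_one ht).le n
  simpa using h

theorem hasSum_qGauss_natCast {t : ℂ} (ht : ‖t‖ < 1) (i : ℕ) :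
    HasSum (fun n : ℕ => t ^ (n ^ 2 + 2 * n) * qPoch (-t) (t ^ 2) n *
        invQFactorial (t ^ 2) (n + (i + 1)) * invQFactorial (t ^ 2) (n - i))
      (qPochInf (-t) (t ^ 2) / qPochInf (t ^ 2) (t ^ 2) *
        (t ^ (i ^ 2 + 2 * i) / (1 + t ^ (2 * i + 1)))) := by
  have ht2 := norm_sq_lt_one ht
  have hinj : Function.Injective fun k : ℕ => k + i := add_left_injective i
  rw [← hinj.hasSum_iff]
  -- After the shift `n = k + i`, the base is `t²` and the parameters are `a = -t^(2i+1)`, `b =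
  -- -t^(2i+3)`.
  · have hab : -t * (t ^ 2) ^ i * (-t * (t ^ 2) ^ (i + 1)) = t ^ 2 * (t ^ 2) ^ (2 * i + 1) := by
      ring
    have hab1 : ‖t ^ 2 * (t ^ 2) ^ (2 * i + 1)‖ < 1 := by
      rw [norm_mul, norm_pow _ (2 * i + 1)]
      exact mul_lt_one_of_nonneg_of_lt_one_left (norm_nonneg _) ht2
        (pow_le_one₀ (norm_nonneg _) ht2.le)
    have hs := (summable_qGaussTerm (a := -t * (t ^ 2) ^ i) (b := -t * (t ^ 2) ^ (i + 1)) ht2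
      (by rwa [hab])).hasSum
    rw [tsum_qGaussTerm ht2 (by rwa [hab]), hab] at hs
    convert! hs.mul_left (t ^ (i ^ 2 + 2 * i) * qPoch (-t) (t ^ 2) i /
      qPoch (t ^ 2) (t ^ 2) (2 * i + 1)) using 1
    · funext k
      have e1 : invQFactorial (t ^ 2) ((k + i : ℕ) + (i + 1)) =
          (qPoch (t ^ 2) (t ^ 2) (2 * i + 1) *
            qPoch (t ^ 2 * (t ^ 2) ^ (2 * i + 1)) (t ^ 2) k)⁻¹ := by
        rw [← qPoch_add, ← invQFactorial_natCast]
        congr 1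
        push_cast
        ring
      have e2 : invQFactorial (t ^ 2) ((k + i : ℕ) - i) = (qPoch (t ^ 2) (t ^ 2) k)⁻¹ := by
        rw [← invQFactorial_natCast]
        congr 1
        push_cast
        ring
      have e3 : t ^ ((k + i) ^ 2 + 2 * (k + i)) = t ^ (i ^ 2 + 2 * i) *
          (-(-t * (t ^ 2) ^ (i + 1))) ^ k * (t ^ 2) ^ k.choose 2 := by
        have : k ^ 2 = k + 2 * k.choose 2 := sq_eq_add_two_mul_choose_two k
        rw [neg_mul, neg_neg, ← pow_mul, ← pow_succ', ← pow_mul, ← pow_mul, ← pow_add, ← pow_add]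
        congr 1
        linear_combination this
      simp only [Function.comp_apply, qGaussTerm]
      rw [e1, e2, e3, hab, add_comm k i, qPoch_add]
      ring
    · have h1 := qPochInf_eq_qPoch_mul (-t) ht2 (i + 1)
      have h2 := qPochInf_eq_qPoch_mul (t ^ 2) ht2 (2 * i + 1)
      have h3 := qPoch_ne_zero ht2 ht2.le (2 * i + 1)
      have h4 := qPochInf_ne_zero hab1 ht2
      have h5 := one_add_mul_pow_ne_zero ht i
      rw [h1, h2, qPoch_succ, show t ^ (2 * i + 1) = t * (t ^ 2) ^ i by ring,
        show 1 - -t * (t ^ 2) ^ i = 1 + t * (t ^ 2) ^ i by ring]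
      generalize 1 + t * (t ^ 2) ^ i = d at *
      field_simp
  · intro n hn
    have : n < i := by
      by_contra h
      exact hn ⟨n - i, by simp; lia⟩
    rw [invQFactorial_of_neg (k := (n : ℤ) - i) _ (by lia), mul_zero]

/-- The summand is symmetric under `j ↦ 1 - j`, so `j = i + 1` and `j = -i` both reduce to the same
sum over natural `i`. -/
theorem hasSum_qGauss_int {t : ℂ} (ht0 : t ≠ 0) (ht : ‖t‖ < 1) (j : ℤ) :
    HasSum (fun n : ℕ => t ^ (n ^ 2 + 2 * n) * qPoch (-t) (t ^ 2) n *
        invQFactorial (t ^ 2) (n + j) * invQFactorial (t ^ 2) (n + 1 - j) *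
          (t ^ ((j - 1) ^ 2) * (1 + t ^ (2 * j - 1))))
      (qPochInf (-t) (t ^ 2) / qPochInf (t ^ 2) (t ^ 2) * t ^ (2 * j ^ 2 - 2 * j)) := by
  rcases lt_or_ge 0 j with hj | hj
  · obtain ⟨i, rfl⟩ : ∃ i : ℕ, j = i + 1 := ⟨j.toNat - 1, by lia⟩
    have h5 : 1 + t ^ (2 * i + 1) ≠ 0 := by
      convert! one_add_mul_pow_ne_zero ht i using 2
      ring
    have e : (2 * ((i : ℤ) + 1) - 1) = (2 * i + 1 : ℕ) := by push_cast; ring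
    convert! (hasSum_qGauss_natCast ht i).mul_right
      (t ^ ((i + 1 - 1 : ℤ) ^ 2) * (1 + t ^ (2 * (i + 1 : ℤ) - 1))) using 1
    · funext n
      rw [show (n + 1 - (i + 1) : ℤ) = n - i by ring]
    · have hp : t ^ (2 * ((i : ℤ) + 1) ^ 2 - 2 * (i + 1)) =
          t ^ (i ^ 2 + 2 * i) * t ^ ((i + 1 - 1 : ℤ) ^ 2) := by
        rw [← zpow_natCast, ← zpow_add₀ ht0]
        congr 1
        push_cast
        ring
      rw [e, zpow_natCast, hp]
      field_simp
  · obtain ⟨i, rfl⟩ : ∃ i : ℕ, j = -i := ⟨(-j).toNat, by lia⟩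
    have h5 : 1 + t ^ (2 * i + 1) ≠ 0 := by
      convert! one_add_mul_pow_ne_zero ht i using 2
      ring
    have e : 1 + t ^ (2 * -(i : ℤ) - 1) = t ^ (-(2 * i + 1 : ℤ)) * (1 + t ^ (2 * i + 1)) := by
      rw [mul_add, mul_one, ← zpow_natCast t, ← zpow_add₀ ht0, add_comm]
      push_cast
      rw [neg_add_cancel, zpow_zero]
      congr 2
      ring
    convert! (hasSum_qGauss_natCast ht i).mul_right
      (t ^ ((-i - 1 : ℤ) ^ 2) * (1 + t ^ (2 * -(i : ℤ) - 1))) using 1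
    · funext n
      rw [show (n + 1 - -i : ℤ) = n + (i + 1) by ring, show (n + -i : ℤ) = n - i by ring]
      ring
    · have hp : t ^ (2 * (-(i : ℤ)) ^ 2 - 2 * -(i : ℤ)) =
          t ^ (i ^ 2 + 2 * i) * t ^ ((-i - 1 : ℤ) ^ 2) * t ^ (-(2 * i + 1 : ℤ)) := by
        rw [← zpow_natCast, ← zpow_add₀ ht0, ← zpow_add₀ ht0]
        congr 1
        push_cast
        ring
      rw [e, hp]
      field_simp

/-! ### Expansion of the inner series in powers of `y`. -/

/-- The coefficients in the expansion of the terms of the inner series in powers of `y`. -/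
noncomputable def seriesCoeff (t : ℂ) (n : ℕ) (j : ℤ) : ℂ :=
  t ^ (n ^ 2 + 2 * n) * qPoch (-t) (t ^ 2) (n + 1) / qPoch (t ^ 2) (t ^ 2) (2 * n + 1) *
    (qPoch (t ^ 2) (t ^ 2) (2 * n) * invQFactorial (t ^ 2) (n + j) *
      invQFactorial (t ^ 2) (n - j))

/-- With `T = t^(2n+1)` and `s = t^(2j-1)`, the two terms combine through `1 + s - T - Ts = (1 -
T)(1 + s)`. The factor `1 - T` cancels what remains of `1 - T²` after `1 + T` from `(-t;t²)_(n+1)`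
is removed. -/
theorem seriesCoeff_add {t : ℂ} (ht0 : t ≠ 0) (ht : ‖t‖ < 1) (n : ℕ) (j : ℤ) :
    seriesCoeff t n j * t ^ j ^ 2 + seriesCoeff t n (j - 1) * t ^ (j - 1) ^ 2 =
      t ^ (n ^ 2 + 2 * n) * qPoch (-t) (t ^ 2) n *
        invQFactorial (t ^ 2) (n + j) * invQFactorial (t ^ 2) (n + 1 - j) *
          (t ^ ((j - 1) ^ 2) * (1 + t ^ (2 * j - 1))) := by
  have ht2 := norm_sq_lt_one ht
  have e2 := invQFactorial_sub_one ht2 (n + 1 - j)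
  have e3 := invQFactorial_sub_one ht2 (n + j)
  rw [show (n + 1 - j - 1 : ℤ) = n - j by ring] at e2
  have h1 := one_add_mul_pow_ne_zero ht n
  have h2 := one_sub_mul_pow_ne_zero ht2 ht2.le (2 * n)
  have h3 := qPoch_ne_zero ht2 ht2.le (2 * n)
  have ht2' : t ^ 2 ≠ 0 := pow_ne_zero 2 ht0
  have hw : t ^ j ≠ 0 := zpow_ne_zero _ ht0
  have hp : (t ^ 2) ^ j = (t ^ j) ^ 2 := by
    rw [← zpow_natCast, ← zpow_natCast, zpow_comm]
  unfold seriesCoeff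
  rw [show (n + (j - 1) : ℤ) = n + j - 1 by ring, show (n - (j - 1) : ℤ) = n + 1 - j by ring,
    e3, e2, qPoch_succ, qPoch_succ, show (j - 1) ^ 2 = j ^ 2 + 1 - j - j by ring,
    show 2 * j - 1 = j + j - 1 by ring, show 1 - -t * (t ^ 2) ^ n = 1 + t * (t ^ 2) ^ n by ring]
  simp only [zpow_add₀ ht2', zpow_sub₀ ht2', zpow_add₀ ht0, zpow_sub₀ ht0, zpow_one,
    zpow_natCast, hp, mul_comm 2 n, pow_mul (t ^ 2)] at h2 h3 ⊢
  generalize invQFactorial (t ^ 2) (n + j) = g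
  generalize invQFactorial (t ^ 2) (n + 1 - j) = h
  generalize t ^ j = w at *
  generalize (t ^ 2) ^ n = x at *
  have h2' : 1 - t ^ 2 * x ^ 2 = (1 - t * x) * (1 + t * x) := by ring
  rw [h2'] at h2 ⊢
  have h4 : 1 - t * x ≠ 0 := left_ne_zero_of_mul h2
  obtain ⟨d, hd⟩ : ∃ d, d = 1 - t * x := ⟨_, rfl⟩
  obtain ⟨e, he⟩ : ∃ e, e = 1 + t * x := ⟨_, rfl⟩
  rw [← hd] at h4 ⊢
  rw [← he] at h1 ⊢
  field_simp
  rw [hd]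
  ring

/-- All `q`-factorials are uniformly bounded, leaving a product of a convergent series in `n` and
one in `j`. -/
theorem summable_seriesCoeff {t : ℂ} (ht : ‖t‖ < 1) (y : ℂ) :
    Summable fun p : ℕ × ℤ => seriesCoeff t p.1 p.2 * (t ^ p.2 ^ 2 * y ^ p.2) := by
  have ht2 := norm_sq_lt_one ht
  obtain ⟨A, hA⟩ := exists_norm_qPoch_le (-t) ht2
  obtain ⟨B, hB⟩ := exists_norm_qPoch_le (t ^ 2) ht2
  obtain ⟨C, hC⟩ := exists_norm_inv_qPoch_le ht2 ht2
  obtain ⟨D, hD0, hD⟩ := exists_norm_invQFactorial_le ht2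
  have hA0 : 0 ≤ A := (norm_nonneg _).trans (hA 0)
  have hB0 : 0 ≤ B := (norm_nonneg _).trans (hB 0)
  have hC0 : 0 ≤ C := (norm_nonneg _).trans (hC 0)
  have h1 : Summable fun n : ℕ => ‖t‖ ^ (n ^ 2 + 2 * n) := by
    refine (summable_pow_mul_pow_sq (‖t‖ ^ 2) (norm_nonneg t) ht).congr fun n => ?_
    rw [← pow_mul, ← pow_add, add_comm]
  have h := (h1.mul_of_nonneg (summable_zpow_sq_mul_zpow ht y) (fun _ => by positivity)
    (fun _ => norm_nonneg _)).mul_left (A * C * (B * D * D))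
  refine h.of_norm_bounded fun ⟨n, j⟩ => ?_
  simp only [seriesCoeff, div_eq_mul_inv, norm_mul _ (t ^ j ^ 2 * y ^ j)]
  rw [norm_mul, norm_mul, norm_mul, norm_mul, norm_mul, norm_pow]
  calc _ ≤ ‖t‖ ^ (n ^ 2 + 2 * n) * A * C * (B * D * D) * ‖t ^ j ^ 2 * y ^ j‖ := by
        have h1 := hA (n + 1)
        have h2 := hB (2 * n)
        have h3 := hC (2 * n + 1)
        have h4 := hD (n + j)
        have h5 := hD (n - j)
        gcongr
    _ = _ := by ring

theorem exists_hasSum_series {t y : ℂ} (ht0 : t ≠ 0) (ht : ‖t‖ < 1) (hy : y ≠ 0) :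
    ∃ S, HasSum (fun n : ℕ => t ^ (n ^ 2 + 2 * n) * qPoch (-t) (t ^ 2) (n + 1) /
        qPoch (t ^ 2) (t ^ 2) (2 * n + 1) *
          (qPoch (-(t * y)) (t ^ 2) n * qPoch (-(t / y)) (t ^ 2) n)) S ∧
      HasSum (fun j : ℤ => qPochInf (-t) (t ^ 2) / qPochInf (t ^ 2) (t ^ 2) *
        (t ^ (2 * j ^ 2 - 2 * j) * y ^ j)) ((1 + y) * S) := by
  have hs := (summable_seriesCoeff ht y).hasSum
  refine ⟨_, hs.prod_fiberwise fun n => ?_, ?_⟩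
  · simpa only [seriesCoeff, mul_assoc] using (hasSum_finite_jacobi ht0 ht hy n).mul_left
      (t ^ (n ^ 2 + 2 * n) * qPoch (-t) (t ^ 2) (n + 1) / qPoch (t ^ 2) (t ^ 2) (2 * n + 1))
  -- The copy multiplied by `y` is reindexed by `j ↦ j - 1`, so both copies contribute to the same
  -- power `y^j`.
  · have hs' := ((Equiv.refl ℕ).prodCongr (Equiv.subRight (1 : ℤ))).hasSum_iff.mpr hs
    have h := (Equiv.prodComm ℤ ℕ).hasSum_iff.mpr (hs.add (hs'.mul_left y))
    rw [← one_add_mul] at h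
    refine h.prod_fiberwise fun j => ?_
    rw [← mul_assoc]
    convert! (hasSum_qGauss_int ht0 ht j).mul_right (y ^ j) using 1
    funext n
    rw [← seriesCoeff_add ht0 ht]
    simp only [Function.comp_apply, Equiv.prodComm_apply, Prod.swap_prod_mk,
      Equiv.prodCongr_apply, Prod.map_apply, Equiv.refl_apply, Equiv.subRight_apply,
      zpow_sub₀ hy, zpow_one]
    field_simp

/-! ### Dissection of the theta series modulo `m`. -/

theorem HasSum.sum_divMod {f : ℤ → ℂ} {a : ℂ} (hf : HasSum f a) {m : ℕ} (hm : 0 < m)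
    {g : ℕ → ℂ} (hg : ∀ r < m, HasSum (fun j : ℤ => f (j * m + r)) (g r)) :
    ∑ r ∈ Finset.range m, g r = a := by
  have : NeZero m := ⟨hm.ne'⟩
  have h := ((Equiv.prodComm (Fin m) ℤ).trans (Int.divModEquiv m).symm).hasSum_iff.mpr hf
  have h' := h.prod_fiberwise (g := fun r : Fin m => g r) fun r => by simpa using! hg r r.2
  rw [Finset.sum_range]
  exact (hasSum_fintype _).unique h'

/-- Triple product with `t = q²` and `y = z/q²`. -/
theorem hasSum_theta {z q : ℂ} (hz : z ≠ 0) (hq : q ≠ 0) (hq1 : ‖q‖ < 1) :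
    HasSum (fun j : ℤ => q ^ (2 * j ^ 2 - 2 * j) * z ^ j)
      (qPochInf (-z) (q ^ 4) * qPochInf (-q ^ 4 / z) (q ^ 4) * qPochInf (q ^ 4) (q ^ 4)) := by
  have h := hasSum_jacobi (pow_ne_zero 2 hq) (norm_sq_lt_one hq1)
    (div_ne_zero hz (pow_ne_zero 2 hq))
  have e1 : q ^ 2 * (z / q ^ 2) = z := by field_simp
  have e2 : q ^ 2 / (z / q ^ 2) = q ^ 4 / z := by field_simp
  rw [e1, e2, ← pow_mul, ← neg_div] at h
  convert! h using 1
  funext j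
  rw [div_zpow, ← zpow_natCast q 2, ← zpow_mul, ← zpow_mul, zpow_sub₀ hq]
  push_cast
  ring

theorem mainTheorem9 (m : ℕ) (hm : 0 < m) (z q : ℂ) (hz : z ≠ 0) (hq : q ≠ 0)
    (hq1 : ‖q‖ < 1) :
    (∀ r ∈ Finset.range m, Summable (fun n : ℕ => dissectionTerm m z q r n)) ∧
    ∑ r ∈ Finset.range m,
        q ^ (2 * (r : ℤ) ^ 2 - 2 * r) * z ^ r *
          (1 + z ^ m * q ^ (2 * (m : ℤ) ^ 2 + (4 * r - 2) * m)) *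
          ∑' n : ℕ, dissectionTerm m z q r n =
      qPochInf (-z) (q ^ 4) * qPochInf (-q ^ 4 / z) (q ^ 4) * qPochInf (q ^ 4) (q ^ 4) *
        (qPochInf (-q ^ (m ^ 2)) (q ^ (2 * m ^ 2)) /
          qPochInf (q ^ (2 * m ^ 2)) (q ^ (2 * m ^ 2))) := by
  have ht0 : q ^ (m ^ 2) ≠ 0 := pow_ne_zero _ hq
  have ht : ‖q ^ (m ^ 2)‖ < 1 := by
    rw [norm_pow]
    exact pow_lt_one₀ (norm_nonneg q) hq1 (pow_pos hm 2).ne'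
  have hp : q ^ (2 * m ^ 2) = (q ^ (m ^ 2)) ^ 2 := by rw [← pow_mul, mul_comm]
  have key : ∀ r : ℕ, ∃ S, HasSum (dissectionTerm m z q r) S ∧
      HasSum (fun j : ℤ => qPochInf (-q ^ (m ^ 2)) (q ^ (2 * m ^ 2)) /
          qPochInf (q ^ (2 * m ^ 2)) (q ^ (2 * m ^ 2)) *
          ((q ^ (m ^ 2)) ^ (2 * j ^ 2 - 2 * j) *
            (z ^ m * q ^ (2 * (m : ℤ) ^ 2 + (4 * r - 2) * m)) ^ j))
        ((1 + z ^ m * q ^ (2 * (m : ℤ) ^ 2 + (4 * r - 2) * m)) * S) := by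
    intro r
    have hy : z ^ m * q ^ (2 * (m : ℤ) ^ 2 + (4 * r - 2) * m) ≠ 0 :=
      mul_ne_zero (pow_ne_zero _ hz) (zpow_ne_zero _ hq)
    obtain ⟨S, h1, h2⟩ := exists_hasSum_series ht0 ht hy
    refine ⟨S, ?_, by rwa [hp]⟩
    have e1 : -(q ^ (m ^ 2) * (z ^ m * q ^ (2 * (m : ℤ) ^ 2 + (4 * r - 2) * m))) =
        -q ^ (3 * (m : ℤ) ^ 2 + m * (4 * r - 2)) * z ^ m := by
      rw [show 3 * (m : ℤ) ^ 2 + m * (4 * r - 2) =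
        (m ^ 2 : ℕ) + (2 * (m : ℤ) ^ 2 + (4 * r - 2) * m) by push_cast; ring,
        zpow_add₀ hq (m ^ 2 : ℕ), zpow_natCast]
      ring
    have e2 : -(q ^ (m ^ 2) / (z ^ m * q ^ (2 * (m : ℤ) ^ 2 + (4 * r - 2) * m))) =
        -1 / (q ^ ((m : ℤ) ^ 2 + m * (4 * r - 2)) * z ^ m) := by
      rw [show 2 * (m : ℤ) ^ 2 + (4 * r - 2) * m =
        (m ^ 2 : ℕ) + ((m : ℤ) ^ 2 + m * (4 * r - 2)) by push_cast; ring,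
        zpow_add₀ hq (m ^ 2 : ℕ), zpow_natCast]
      have := zpow_ne_zero ((m : ℤ) ^ 2 + m * (4 * r - 2)) hq
      field_simp
    rw [e1, e2] at h1
    convert! h1 using 1
    funext n
    rw [dissectionTerm, hp, ← pow_mul q (m ^ 2) (n ^ 2 + 2 * n)]
    ring
  choose S hS1 hS2 using key
  refine ⟨fun r _ => (hS1 r).summable, ?_⟩
  refine HasSum.sum_divMod ((hasSum_theta hz hq hq1).mul_right _) hm fun r _ => ?_
  rw [(hS1 r).tsum_eq, mul_assoc]
  convert! (hS2 r).mul_left (q ^ (2 * (r : ℤ) ^ 2 - 2 * r) * z ^ r) using 1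
  funext j
  -- The cross term `4jmr` of the square is absorbed into `y^j`; this dictates the choice of `y`.
  have e1 : q ^ (2 * (j * m + r) ^ 2 - 2 * (j * m + r)) = q ^ (2 * (r : ℤ) ^ 2 - 2 * r) *
      ((q ^ (m ^ 2)) ^ (2 * j ^ 2 - 2 * j) *
        (q ^ (2 * (m : ℤ) ^ 2 + (4 * r - 2) * m)) ^ j) := by
    rw [← zpow_natCast q (m ^ 2), ← zpow_mul, ← zpow_mul, ← zpow_add₀ hq, ← zpow_add₀ hq]
    congr 1
    push_cast
    ring
  have e2 : z ^ (j * m + r) = z ^ r * (z ^ m) ^ j := by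
    rw [zpow_add₀ hz, mul_comm j, zpow_mul, zpow_natCast, zpow_natCast, mul_comm]
  rw [e1, e2, mul_zpow]
  ring
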